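/- All Banach spaces are real. For Banach spaces $X,Y$ let $d(X,Y)=\inf\{\|T\|\,\|T^{-1}\| : T\colon X\to Y \text{ an isomorphism}\}$ be the Banach–Mazur distance. For $\lambda>0$, $X$ is an $\mathcal L_{\infty,\lambda}$-space if every finite-dimensional subspace $F$ of $X$ is contained in a finite-dimensional subspace $E$ of $X$ with $d(E,\ell_\infty^{\dim E})\le\lambda$. For $\varepsilon\ge 0$, a map $f\colon X\to Y$ is a standard $\varepsilon$-isometry if $f(0)=0$ and $\big|\|f(x)-f(y)\|-\|x-y\|\big|\le\varepsilon$ for all $x,y\in X$. Let $L(f)$ be the closed linear span of $f(X)$ in $Y$. For $a,c>0$, $X$ is universally $(a,c)$ left-stable if for every Banach space $Y$, every $\varepsilon\ge0$ and every standard $\varepsilon$-isometry $f\colon X\to Y$ there is a bounded linear operator $T\colon L(f)\to X$ with $\|T\|\le a$ and $\|Tf(x)-x\|\le c\,\varepsilon$ for all $x\in X$. $X$ is $\mu$-injective if every bounded linear operator $T$ from a closed subspace of a Banach space $W$ into $X$ extends to a bounded linear operator $W\to X$ of norm at most $\mu\|T\|$. **Theorem.** Let $\lambda>0$ and let $X$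 be a Banach space that is an $\mathcal L_{\infty,\lambda}$-space. (i) For every Banach space $Y$, every $\varepsilon\ge0$ and every standard $\varepsilon$-isometry $f\colon X\to Y$ there is a bounded linear operator $T\colon Y\to X^{**}$ with $\|T\|\le\lambda$ such that $\|Tf(x)-x\|\le 4\lambda\varepsilon$ for all $x\in X$, where $X$ is canonically embedded in $X^{**}$. (ii) If, in addition, $X$ is isomorphic to the dual $M^*$ of a Banach space $M$, then for every real $\alpha>d(X,M^*)$ the space $X$ is universally $(\lambda\alpha,4\lambda\alpha)$ left-stable, and $X$ is $\lambda\alpha$-injective. -/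

import Mathlib

set_option maxSynthPendingDepth 3

open scoped ENNReal

/-- The Banach-Mazur distance `d(X, Y) = inf ‖T‖ ‖T⁻¹‖` over all isomorphisms `T : X → Y`;
it is `∞` when `X` and `Y` are not isomorphic. -/
noncomputable def banachMazurDist (X Y : Type*) [NormedAddCommGroup X] [NormedSpace ℝ X]
    [NormedAddCommGroup Y] [NormedSpace ℝ Y] : ℝ≥0∞ :=
  ⨅ T : X ≃L[ℝ] Y, ‖(T : X →L[ℝ] Y)‖ₑ * ‖(T.symm : Y →L[ℝ] X)‖ₑ

/-- `X` is an `𝓛_{∞,lam}`-space: each finite-dimensional subspace `F` lies in a finite-dimensional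
subspace `E` with `d(E, ℓ_∞^{dim E}) ≤ lam`. The type `Fin n → ℝ` carries the sup norm, so it
is `ℓ_∞^n`. -/
def IsLInftySpace (lam : ℝ) (X : Type*) [NormedAddCommGroup X] [NormedSpace ℝ X] : Prop :=
  ∀ F : Submodule ℝ X, FiniteDimensional ℝ F →
    ∃ E : Submodule ℝ X, F ≤ E ∧ FiniteDimensional ℝ E ∧
      banachMazurDist E (Fin (Module.finrank ℝ E) → ℝ) ≤ ENNReal.ofReal lam

/-- `f` is a standard `ε`-isometry (with `ε ≥ 0`). Neither linearity nor continuity is assumed. -/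
structure IsStandardEpsIsometry {X Y : Type*} [NormedAddCommGroup X] [NormedAddCommGroup Y]
    (ε : ℝ) (f : X → Y) : Prop where
  eps_nonneg : 0 ≤ ε
  map_zero : f 0 = 0
  abs_sub_le : ∀ x y : X, |‖f x - f y‖ - ‖x - y‖| ≤ ε

/-- `L(f)`, the closed linear span of the range of `f`. -/
def closedSpanRange {X Y : Type*} [NormedAddCommGroup Y] [NormedSpace ℝ Y] (f : X → Y) :
    Submodule ℝ Y :=
  (Submodule.span ℝ (Set.range f)).topologicalClosure

theorem mem_closedSpanRange {X Y : Type*} [NormedAddCommGroup Y] [NormedSpace ℝ Y] (f : X → Y)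
    (x : X) : f x ∈ closedSpanRange f :=
  Submodule.le_topologicalClosure _ (Submodule.subset_span (Set.mem_range_self x))

/-- The `(α, γ)`-stability of a standard `ε`-isometry `f : X → Y`: there is a bounded linear
`T : L(f) → X` with `‖T‖ ≤ α` and `‖T f(x) - x‖ ≤ γ ε` for all `x`. -/
def IsStableEpsIsometry {X Y : Type*} [NormedAddCommGroup X] [NormedSpace ℝ X]
    [NormedAddCommGroup Y] [NormedSpace ℝ Y] (α γ ε : ℝ) (f : X → Y) : Prop :=
  0 < α ∧ 0 < γ ∧ ∃ T : closedSpanRange f →L[ℝ] X,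
    ‖T‖ ≤ α ∧ ∀ x : X, ‖T ⟨f x, mem_closedSpanRange f x⟩ - x‖ ≤ γ * ε

/-- The pair `(X, Y)` is `(α, γ)`-stable: every standard `ε`-isometry `X → Y` is. -/
def IsStablePair (α γ : ℝ) (X Y : Type*) [NormedAddCommGroup X] [NormedSpace ℝ X]
    [NormedAddCommGroup Y] [NormedSpace ℝ Y] : Prop :=
  ∀ (ε : ℝ) (f : X → Y), IsStandardEpsIsometry ε f → IsStableEpsIsometry α γ ε f

universe u v w z

/-- `X` is universally `(α, γ)` left-stable: `(X, Y)` is `(α, γ)`-stable for every Banach space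
`Y` (in an arbitrary universe `v`). -/
def IsUniversallyLeftStable (α γ : ℝ) (X : Type u) [NormedAddCommGroup X] [NormedSpace ℝ X] :
    Prop :=
  ∀ (Y : Type v) [NormedAddCommGroup Y] [NormedSpace ℝ Y] [CompleteSpace Y],
    IsStablePair α γ X Y

/-- `X` is `μ`-injective: every bounded linear operator `T` from a closed subspace `Z` of a Banach
space `W` (in an arbitrary universe `v`) into `X` extends to `W` with norm at most `μ ‖T‖`. -/
def IsInjectiveWithConst (μ : ℝ) (X : Type u) [NormedAddCommGroup X] [NormedSpace ℝ X] : Prop :=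
  ∀ (W : Type v) [NormedAddCommGroup W] [NormedSpace ℝ W] [CompleteSpace W]
    (Z : Submodule ℝ W), IsClosed (Z : Set W) → ∀ T : Z →L[ℝ] X,
      ∃ S : W →L[ℝ] X, (∀ z : Z, S z = T z) ∧ ‖S‖ ≤ μ * ‖T‖

/-! For a standard `ε`-isometry `f` on a finite-dimensional space `E`, every functional of norm at
most 1 is within `3ε` of some `φ ∘ f` with `‖φ‖ ≤ 1`. The functionals with this property form a
closed convex set containing every derivative of the norm. Points of differentiability are dense and
the derivative at `v` norms `v`, so Hahn–Banach separation puts the whole dual ball in the set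
(`mem_representedFunctionals_of_norm_le_one`).

If `E` is close to `ℓ_∞ⁿ`, applying this to the `n` coordinates gives a linear approximate left
inverse of `f`: the sup norm assembles coordinates without loss. Such subspaces absorb every finite
set of an `𝓛_∞`-space, and a weak* limit of the local inverses has values in the bidual
(`exists_bidual_limit`).

Injectivity follows the same scheme with coordinatewise Hahn–Banach extension. An isomorphism with a
dual space provides a projection of the bidual that brings the values back to `X`. -/

open Filter Topology NormedSpace

/-! ### Weak* limits of operators along ultrafilters -/

section Limits

variable {ι : Type*} {W V : Type*} [NormedAddCommGroup W] [NormedSpace ℝ W]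
  [NormedAddCommGroup V] [NormedSpace ℝ V]

/-- Operators into a dual space with convergent norm bounds have a pointwise weak* limit along
an ultrafilter. -/
theorem exists_weakStar_limit (U : Ultrafilter ι) (S : ι → W →L[ℝ] StrongDual ℝ V) (C : ι → ℝ)
    (c : ℝ) (hS : ∀ i, ‖S i‖ ≤ C i) (hC : Tendsto C U (𝓝 c)) :
    ∃ T : W →L[ℝ] StrongDual ℝ V, ‖T‖ ≤ c ∧
      ∀ w v, Tendsto (fun i => S i w v) U (𝓝 (T w v)) := by
  have hb : ∀ i w v, |S i w v| ≤ C i * ‖w‖ * ‖v‖ := fun i w v =>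
    (ContinuousLinearMap.le_opNorm₂ (S i) w v).trans (by gcongr; exact hS i)
  have hlim : ∀ w v, ∃ a, Tendsto (fun i => S i w v) U (𝓝 a) := by
    intro w v
    have hev : ∀ᶠ i in (U : Filter ι), S i w v ∈
        Metric.closedBall (0 : ℝ) ((c + 1) * ‖w‖ * ‖v‖) := by
      filter_upwards [hC.eventually_le_const (lt_add_one c)] with i hi
      rw [mem_closedBall_zero_iff, Real.norm_eq_abs]
      exact (hb i w v).trans (by gcongr)
    obtain ⟨a, -, ha⟩ := (isCompact_closedBall (0 : ℝ) ((c + 1) * ‖w‖ * ‖v‖)).ultrafilter_le_nhds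
      (U.map fun i => S i w v) (le_principal_iff.2 hev)
    exact ⟨a, ha⟩
  choose b hlim using hlim
  have hc : 0 ≤ c := ge_of_tendsto' hC fun i => (norm_nonneg _).trans (hS i)
  let B : W →ₗ[ℝ] V →ₗ[ℝ] ℝ := LinearMap.mk₂ ℝ b
    (fun w₁ w₂ v => tendsto_nhds_unique (hlim (w₁ + w₂) v)
      (by simpa using (hlim w₁ v).add (hlim w₂ v)))
    (fun a w v => tendsto_nhds_unique (hlim (a • w) v) (by simpa using (hlim w v).const_mul a))
    (fun w v₁ v₂ => tendsto_nhds_unique (hlim w (v₁ + v₂))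
      (by simpa using (hlim w v₁).add (hlim w v₂)))
    (fun a w v => tendsto_nhds_unique (hlim w (a • v)) (by simpa using (hlim w v).const_mul a))
  have hB : ∀ w v, ‖B w v‖ ≤ c * ‖w‖ * ‖v‖ := fun w v =>
    le_of_tendsto_of_tendsto' (hlim w v).norm ((hC.mul_const _).mul_const _) fun i => hb i w v
  exact ⟨B.mkContinuous₂ c hB, B.mkContinuous₂_norm_le hc hB, hlim⟩

/-- A functional is an operator from `ℝ` into the dual, evaluated at 1. -/
theorem exists_weakStar_limit_functional (U : Ultrafilter ι) (φ : ι → StrongDual ℝ V) (c : ℝ)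
    (hφ : ∀ i, ‖φ i‖ ≤ c) :
    ∃ ψ : StrongDual ℝ V, ‖ψ‖ ≤ c ∧ ∀ v, Tendsto (fun i => φ i v) U (𝓝 (ψ v)) := by
  obtain ⟨T, hT, hlim⟩ := exists_weakStar_limit U
    (fun i => ContinuousLinearMap.toSpanSingleton ℝ (φ i)) (fun _ => c) c
    (fun i => by simpa using hφ i) tendsto_const_nhds
  exact ⟨T 1, by simpa using T.le_of_opNorm_le hT 1, fun v => by simpa using hlim 1 v⟩

/-- A net of operators into `V` with convergent norm bounds has a limit operator into the bidual
which preserves eventual norm estimates. -/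
theorem exists_bidual_limit (l : Filter ι) [l.NeBot] (S : ι → W →L[ℝ] V) (C : ι → ℝ)
    (c : ℝ) (hS : ∀ i, ‖S i‖ ≤ C i) (hC : Tendsto C l (𝓝 c)) :
    ∃ T : W →L[ℝ] StrongDual ℝ (StrongDual ℝ V), ‖T‖ ≤ c ∧
      ∀ w v (D : ι → ℝ) (d : ℝ), Tendsto D l (𝓝 d) → (∀ᶠ i in l, ‖S i w - v‖ ≤ D i) →
        ‖T w - inclusionInDoubleDual ℝ V v‖ ≤ d := by
  have hU : (Ultrafilter.of l : Filter ι) ≤ l := Ultrafilter.of_le l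
  obtain ⟨T, hT, hlim⟩ := exists_weakStar_limit (Ultrafilter.of l)
    (fun i => (inclusionInDoubleDual ℝ V).comp (S i)) C c
    (fun i => (ContinuousLinearMap.opNorm_comp_le _ _).trans <|
      (mul_le_of_le_one_left (norm_nonneg _) (inclusionInDoubleDual_norm_le ℝ V)).trans (hS i))
    (hC.mono_left hU)
  refine ⟨T, hT, fun w v D d hD hev => ContinuousLinearMap.opNorm_le_bound _ ?_ fun g => ?_⟩
  · refine ge_of_tendsto hD ?_
    filter_upwards [hev] with i hi using (norm_nonneg _).trans hi
  · have h := ((hlim w g).sub_const (g v)).norm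
    refine le_of_tendsto_of_tendsto h ((hD.mono_left hU).mul_const ‖g‖) ?_
    filter_upwards [hU hev] with i hi
    have : ((inclusionInDoubleDual ℝ V).comp (S i)) w g - g v = g (S i w - v) := by
      simp [dual_def]
    rw [this, mul_comm]
    exact (g.le_opNorm _).trans (by gcongr)

end Limits

/-! ### Functionals represented through an `ε`-isometry -/

section WeakStability

variable {E Y : Type*} [NormedAddCommGroup E] [NormedSpace ℝ E]
  [NormedAddCommGroup Y] [NormedSpace ℝ Y]

/-- The functionals on `E` that are represented through `f`, up to the error `c`, by a functional
in the dual unit ball of `Y`. -/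
def representedFunctionals (f : E → Y) (c : ℝ) : Set (StrongDual ℝ E) :=
  {g | ∃ φ : StrongDual ℝ Y, ‖φ‖ ≤ 1 ∧ ∀ x, |φ (f x) - g x| ≤ c}

theorem convex_representedFunctionals (f : E → Y) (c : ℝ) :
    Convex ℝ (representedFunctionals f c) := by
  rintro g ⟨φ, hφ, hg⟩ h ⟨ψ, hψ, hh⟩ a b ha hb hab
  refine ⟨a • φ + b • ψ, ?_, fun x => ?_⟩
  · have := convex_closedBall (0 : StrongDual ℝ Y) 1 (mem_closedBall_zero_iff.2 hφ)
      (mem_closedBall_zero_iff.2 hψ) ha hb hab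
    simpa using this
  · have := convex_closedBall (0 : ℝ) c (mem_closedBall_zero_iff.2 (hg x))
      (mem_closedBall_zero_iff.2 (hh x)) ha hb hab
    rw [mem_closedBall_zero_iff, Real.norm_eq_abs] at this
    convert this using 2
    simp
    ring

/-- The representing `φ n` need not converge in norm, but a weak* limit of them keeps the norm bound
and the estimate at each `x`. -/
theorem isClosed_representedFunctionals (f : E → Y) (c : ℝ) :
    IsClosed (representedFunctionals f c) := by
  refine isClosed_of_closure_subset fun g hg => ?_
  obtain ⟨s, hs, hlim⟩ := mem_closure_iff_seq_limit.1 hg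
  choose φ hφ hsφ using hs
  obtain ⟨ψ, hψ, hψlim⟩ := exists_weakStar_limit_functional (hyperfilter ℕ) φ 1 hφ
  refine ⟨ψ, hψ, fun x => ?_⟩
  have hx : Tendsto (fun n => s n x) (hyperfilter ℕ : Filter ℕ) (𝓝 (g x)) :=
    (((ContinuousLinearMap.apply ℝ ℝ x).continuous.tendsto g).comp hlim).mono_left
      Nat.hyperfilter_le_atTop
  exact le_of_tendsto' ((hψlim (f x)).sub hx).abs fun n => hsφ n x

/-- The derivative of the norm is represented through every standard `ε`-isometry. -/
theorem fderiv_norm_mem_representedFunctionals {ε : ℝ} {f : E → Y}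
    (hf : IsStandardEpsIsometry ε f) {v : E} (hv : DifferentiableAt ℝ (‖·‖) v) :
    fderiv ℝ (‖·‖) v ∈ representedFunctionals f (3 * ε) := by
  have key : ∀ n : ℕ, ∃ φ : StrongDual ℝ Y, ‖φ‖ ≤ 1 ∧ ∀ x,
      n * ‖v‖ - ‖(n : ℝ) • v - x‖ - 3 * ε ≤ φ (f x) ∧
      φ (f x) ≤ ‖(n : ℝ) • v + x‖ - n * ‖v‖ + 3 * ε := by
    intro n
    -- Choose `φ` norming `f (nv) - f (-nv)`, whose norm is at least `2n‖v‖ - ε`. Each of `φ (f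
    -- (nv))` and `-φ (f (-nv))` is at most `n‖v‖ + ε`, hence at least `n‖v‖ - 2ε`. Comparing `f x`
    -- with `f (±nv)` costs the third `ε`.
    obtain ⟨φ, hφ, hφn⟩ := exists_dual_vector'' ℝ (f ((n : ℝ) • v) - f (-((n : ℝ) • v)))
    have hsub : ∀ x y, φ (f x) - φ (f y) ≤ ‖x - y‖ + ε := fun x y => by
      rw [← map_sub]
      have h1 := (le_abs_self _).trans (φ.le_of_opNorm_le hφ (f x - f y))
      have h2 := (abs_le.1 (hf.abs_sub_le x y)).2
      linarith
    have hnv : ‖(n : ℝ) • v‖ = n * ‖v‖ := by simp [norm_smul]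
    have hbig : 2 * (n * ‖v‖) - ε ≤ φ (f ((n : ℝ) • v)) - φ (f (-((n : ℝ) • v))) := by
      have h := (abs_le.1 (hf.abs_sub_le ((n : ℝ) • v) (-((n : ℝ) • v)))).1
      have h2 : ‖(n : ℝ) • v - -((n : ℝ) • v)‖ = 2 * (n * ‖v‖) := by
        rw [sub_neg_eq_add, ← two_smul ℝ, norm_smul, hnv]; simp
      rw [h2] at h
      rw [map_sub] at hφn
      simp only [RCLike.ofReal_real_eq_id, id] at hφn
      linarith
    have h0 : φ (f 0) = 0 := by rw [hf.map_zero, map_zero]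
    have hp := hsub ((n : ℝ) • v) 0
    have hm := hsub 0 (-((n : ℝ) • v))
    rw [h0, sub_zero, sub_zero, hnv] at hp
    rw [h0, zero_sub, zero_sub, neg_neg, hnv] at hm
    refine ⟨φ, hφ, fun x => ⟨?_, ?_⟩⟩
    · have := hsub ((n : ℝ) • v) x
      linarith
    · have := hsub x (-((n : ℝ) • v))
      rw [sub_neg_eq_add, add_comm x] at this
      linarith
  choose φ hφ hφx using key
  obtain ⟨ψ, hψ, hψlim⟩ := exists_weakStar_limit_functional (hyperfilter ℕ) φ 1 hφ
  have hU := Nat.hyperfilter_le_atTop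
  -- The expression equals `n (‖v + x/n‖ - ‖v‖)`, a difference quotient. Used at `x` and at `-x`, it
  -- squeezes the limit functional from both sides.
  have hder : ∀ x, Tendsto (fun n : ℕ => ‖(n : ℝ) • v + x‖ - n * ‖v‖) (hyperfilter ℕ : Filter ℕ)
      (𝓝 (fderiv ℝ (‖·‖) v x)) := by
    intro x
    have h := ((hv.hasFDerivAt.lim_real x).comp tendsto_natCast_atTop_atTop).mono_left hU
    refine h.congr' ?_
    filter_upwards [hU (eventually_ne_atTop 0)] with n hn
    have hn' : (n : ℝ) ≠ 0 := Nat.cast_ne_zero.2 hn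
    have : (n : ℝ) • v + x = (n : ℝ) • (v + (n : ℝ)⁻¹ • x) := by
      rw [smul_add, smul_inv_smul₀ hn']
    rw [this, norm_smul]
    simp [mul_sub]
  refine ⟨ψ, hψ, fun x => abs_le.2 ⟨?_, ?_⟩⟩
  · have h := hder (-x)
    have h2 := le_of_tendsto_of_tendsto' (h.neg.sub_const (3 * ε)) (hψlim (f x)) fun n => by
      have := (hφx n x).1
      rw [sub_eq_add_neg ((n : ℝ) • v)] at this
      linarith
    rw [map_neg] at h2
    linarith
  · have := le_of_tendsto_of_tendsto' (hψlim (f x)) ((hder x).add_const (3 * ε))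
      fun n => (hφx n x).2
    linarith

/-- Reflexivity: a functional separating points of the dual becomes evaluation at a vector of `E`.
-/
theorem exists_eval_eq_of_finiteDimensional [FiniteDimensional ℝ E]
    (Ψ : StrongDual ℝ (StrongDual ℝ E)) : ∃ u : E, ∀ g, Ψ g = g u := by
  refine ⟨(Module.evalEquiv ℝ E).symm
    (Ψ.toLinearMap ∘ₗ (LinearMap.toContinuousLinearMap (𝕜 := ℝ) (E := E) (F' := ℝ)).toLinearMap),
    fun g => ?_⟩
  have := Module.apply_evalEquiv_symm_apply (R := ℝ) (M := E) g.toLinearMap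
    (Ψ.toLinearMap ∘ₗ (LinearMap.toContinuousLinearMap (𝕜 := ℝ) (E := E) (F' := ℝ)).toLinearMap)
  exact this.symm

/-- Weak stability of standard `ε`-isometries of a finite-dimensional space. -/
theorem mem_representedFunctionals_of_norm_le_one [FiniteDimensional ℝ E] {ε : ℝ} {f : E → Y}
    (hf : IsStandardEpsIsometry ε f) {g : StrongDual ℝ E} (hg : ‖g‖ ≤ 1) :
    g ∈ representedFunctionals f (3 * ε) := by
  by_contra hmem
  obtain ⟨Ψ, s, hs, hgs⟩ := geometric_hahn_banach_closed_point
    (convex_representedFunctionals f _) (isClosed_representedFunctionals f _) hmem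
  obtain ⟨u, hu⟩ := exists_eval_eq_of_finiteDimensional Ψ
  rw [hu] at hgs
  have hgu : g u ≤ ‖u‖ := by simpa using (le_abs_self _).trans (g.le_of_opNorm_le hg u)
  -- With `D` the derivative of the norm at `v`, `D u = ‖v‖ - D (v - u) ≥ ‖u‖ - 2‖u - v‖ > ‖u‖ - (g
  -- u - s) ≥ s`, contradicting the separation `D u < s`.
  obtain ⟨v, hv, huv⟩ := (dense_differentiableAt_norm (E := E)).exists_dist_lt u
    (show 0 < (g u - s) / 2 by linarith)
  have h1 := hs _ (fderiv_norm_mem_representedFunctionals hf hv)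
  rw [hu] at h1
  have h2 : fderiv ℝ (‖·‖) v v = ‖v‖ := hv.fderiv_norm_self
  have h3 : fderiv ℝ (‖·‖) v (v - u) ≤ ‖v - u‖ := by
    have : ‖fderiv ℝ (fun x : E => ‖x‖) v‖ ≤ 1 :=
      NNReal.coe_one ▸ norm_fderiv_le_of_lipschitz ℝ lipschitzWith_one_norm
    simpa using (le_abs_self _).trans ((fderiv ℝ (‖·‖) v).le_of_opNorm_le this (v - u))
  rw [map_sub, h2] at h3
  have h4 := norm_sub_norm_le u v
  rw [dist_eq_norm] at huv
  rw [norm_sub_rev v u] at h3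
  linarith

theorem exists_functional_approx [FiniteDimensional ℝ E] {ε : ℝ} {f : E → Y}
    (hf : IsStandardEpsIsometry ε f) (g : StrongDual ℝ E) :
    ∃ φ : StrongDual ℝ Y, ‖φ‖ ≤ ‖g‖ ∧ ∀ x, |φ (f x) - g x| ≤ 3 * ε * ‖g‖ := by
  rcases eq_or_ne g 0 with rfl | hg
  · exact ⟨0, by simp, by simp⟩
  have hg0 : ‖g‖ ≠ 0 := norm_ne_zero_iff.2 hg
  obtain ⟨φ, hφ, h⟩ := mem_representedFunctionals_of_norm_le_one hf
    (g := ‖g‖⁻¹ • g) (by simp [norm_smul, hg0])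
  refine ⟨‖g‖ • φ, ?_, fun x => ?_⟩
  · rw [norm_smul, norm_norm]
    exact mul_le_of_le_one_right (norm_nonneg _) hφ
  · have : (‖g‖ • φ) (f x) - g x = ‖g‖ * (φ (f x) - (‖g‖⁻¹ • g) x) := by
      simp [mul_sub, mul_inv_cancel_left₀ hg0]
    rw [this, abs_mul, abs_norm, mul_comm]
    gcongr
    exact h x

end WeakStability

/-! ### Local inverses and extensions, and their limits in the bidual -/

section LInfty

variable {E X Y : Type*} [NormedAddCommGroup E] [NormedSpace ℝ E]
  [NormedAddCommGroup X] [NormedSpace ℝ X] [NormedAddCommGroup Y] [NormedSpace ℝ Y]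

theorem exists_equiv_norm_mul_lt {c : ℝ} (h : banachMazurDist E Y < ENNReal.ofReal c) :
    ∃ A : E ≃L[ℝ] Y, ‖(A : E →L[ℝ] Y)‖ * ‖(A.symm : Y →L[ℝ] E)‖ < c := by
  obtain ⟨A, hA⟩ := iInf_lt_iff.1 h
  refine ⟨A, ?_⟩
  rw [← ofReal_norm, ← ofReal_norm, ← ENNReal.ofReal_mul (norm_nonneg _)] at hA
  exact (ENNReal.ofReal_lt_ofReal_iff_of_nonneg (by positivity)).1 hA

/-- In an `𝓛_∞`-space, a finite set lies in a subspace that is almost `lam`-isomorphic to a finite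
dimensional `ℓ_∞`. -/
theorem IsLInftySpace.exists_finset_subset {lam : ℝ} (hlam : 0 < lam) (hX : IsLInftySpace lam X)
    (s : Finset X) {δ : ℝ} (hδ : 0 < δ) :
    ∃ E : Submodule ℝ X, (s : Set X) ⊆ E ∧ FiniteDimensional ℝ E ∧
      ∃ (n : ℕ) (A : E ≃L[ℝ] (Fin n → ℝ)),
        ‖(A : E →L[ℝ] (Fin n → ℝ))‖ * ‖(A.symm : (Fin n → ℝ) →L[ℝ] E)‖ ≤ lam + δ := by
  obtain ⟨E, hsE, hE, hd⟩ := hX (Submodule.span ℝ (s : Set X))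
    (FiniteDimensional.span_finset ℝ s)
  -- The distance is an infimum, so the slack `δ` secures an actual isomorphism.
  obtain ⟨A, hA⟩ := exists_equiv_norm_mul_lt (hd.trans_lt
    ((ENNReal.ofReal_lt_ofReal_iff (by linarith)).2 (lt_add_of_pos_right lam hδ)))
  exact ⟨E, Submodule.subset_span.trans hsE, hE, _, A, hA.le⟩

theorem norm_coord_le {n : ℕ} (A : E →L[ℝ] (Fin n → ℝ)) (i : Fin n) :
    ‖(ContinuousLinearMap.proj i).comp A‖ ≤ ‖A‖ :=
  ContinuousLinearMap.opNorm_le_bound _ (norm_nonneg _) fun x =>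
    (norm_le_pi_norm (A x) i).trans (A.le_opNorm x)

/-- A standard `ε`-isometry of a space isomorphic to `ℓ_∞ⁿ` has an approximate linear left
inverse. -/
theorem exists_approx_left_inverse {n : ℕ} (A : E ≃L[ℝ] (Fin n → ℝ)) {ε : ℝ} {f : E → Y}
    (hf : IsStandardEpsIsometry ε f) {c : ℝ}
    (hA : ‖(A : E →L[ℝ] (Fin n → ℝ))‖ * ‖(A.symm : (Fin n → ℝ) →L[ℝ] E)‖ ≤ c) :
    ∃ S : Y →L[ℝ] E, ‖S‖ ≤ c ∧ ∀ x, ‖S (f x) - x‖ ≤ 3 * ε * c := by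
  have : FiniteDimensional ℝ E := LinearEquiv.finiteDimensional A.symm.toLinearEquiv
  have hε := hf.eps_nonneg
  choose φ hφ hφx using fun i => exists_functional_approx hf
    ((ContinuousLinearMap.proj (R := ℝ) (φ := fun _ : Fin n => ℝ) i).comp
      (A : E →L[ℝ] (Fin n → ℝ)))
  have hn := norm_coord_le (A : E →L[ℝ] (Fin n → ℝ))
  have hpi : ‖ContinuousLinearMap.pi φ‖ ≤ ‖(A : E →L[ℝ] (Fin n → ℝ))‖ :=
    ContinuousLinearMap.opNorm_le_bound _ (norm_nonneg _) fun y =>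
      (pi_norm_le_iff_of_nonneg (by positivity)).2 fun i =>
        (φ i).le_of_opNorm_le ((hφ i).trans (hn i)) y
  refine ⟨(A.symm : (Fin n → ℝ) →L[ℝ] E).comp (ContinuousLinearMap.pi φ), ?_, fun x => ?_⟩
  · refine (ContinuousLinearMap.opNorm_comp_le _ _).trans (le_trans ?_ hA)
    rw [mul_comm]
    gcongr
  · have hx : (A.symm : (Fin n → ℝ) →L[ℝ] E).comp (ContinuousLinearMap.pi φ) (f x) - x =
        (A.symm : (Fin n → ℝ) →L[ℝ] E) (ContinuousLinearMap.pi φ (f x) - A x) := by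
      simp
    have hle : ‖ContinuousLinearMap.pi φ (f x) - A x‖ ≤ 3 * ε * ‖(A : E →L[ℝ] (Fin n → ℝ))‖ :=
      (pi_norm_le_iff_of_nonneg (by positivity)).2 fun i =>
        (hφx i x).trans (by gcongr; exact hn i)
    rw [hx]
    refine ((A.symm : (Fin n → ℝ) →L[ℝ] E).le_opNorm_of_le hle).trans ?_
    calc _ = 3 * ε * (‖(A : E →L[ℝ] (Fin n → ℝ))‖ * ‖(A.symm : (Fin n → ℝ) →L[ℝ] E)‖) := by ring
      _ ≤ _ := by gcongr

/-- Operators into a space isomorphic to `ℓ_∞ⁿ` extend from subspaces. -/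
theorem exists_extension_of_equiv_pi {n : ℕ} (A : E ≃L[ℝ] (Fin n → ℝ)) {c : ℝ}
    (hA : ‖(A : E →L[ℝ] (Fin n → ℝ))‖ * ‖(A.symm : (Fin n → ℝ) →L[ℝ] E)‖ ≤ c)
    (G : Submodule ℝ Y) (T : G →L[ℝ] E) :
    ∃ S : Y →L[ℝ] E, ‖S‖ ≤ c * ‖T‖ ∧ ∀ z : G, S z = T z := by
  choose φ hφx hφ using fun i => exists_extension_norm_eq G
    ((ContinuousLinearMap.proj (R := ℝ) (φ := fun _ : Fin n => ℝ) i).comp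
      ((A : E →L[ℝ] (Fin n → ℝ)).comp T))
  have hpi : ‖ContinuousLinearMap.pi φ‖ ≤ ‖(A : E →L[ℝ] (Fin n → ℝ))‖ * ‖T‖ :=
    ContinuousLinearMap.opNorm_le_bound _ (by positivity) fun y =>
      (pi_norm_le_iff_of_nonneg (by positivity)).2 fun i =>
        (φ i).le_of_opNorm_le ((hφ i).le.trans ((norm_coord_le _ i).trans
          (ContinuousLinearMap.opNorm_comp_le _ _))) y
  refine ⟨(A.symm : (Fin n → ℝ) →L[ℝ] E).comp (ContinuousLinearMap.pi φ), ?_, fun z => ?_⟩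
  · refine (ContinuousLinearMap.opNorm_comp_le _ _).trans ?_
    calc _ ≤ ‖(A.symm : (Fin n → ℝ) →L[ℝ] E)‖ * (‖(A : E →L[ℝ] (Fin n → ℝ))‖ * ‖T‖) := by gcongr
      _ = ‖(A : E →L[ℝ] (Fin n → ℝ))‖ * ‖(A.symm : (Fin n → ℝ) →L[ℝ] E)‖ * ‖T‖ := by ring
      _ ≤ _ := by gcongr
  · have : ContinuousLinearMap.pi φ (z : Y) = A (T z) := by
      ext i
      simpa using hφx i z
    simp [this]

/-- In the index `(s, m)`, `s` is the finite set where the local operator is controlled and `m`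
shrinks the slack in the constant. -/
theorem tendsto_const_add_one_div_snd (ι : Type*) [Preorder ι] (c : ℝ) :
    Tendsto (fun p : ι × ℕ => c + 1 / ((p.2 : ℝ) + 1)) atTop (𝓝 c) := by
  have h : Tendsto (fun p : ι × ℕ => 1 / ((p.2 : ℝ) + 1)) atTop (𝓝 0) := by
    rw [← prod_atTop_atTop_eq]
    exact tendsto_one_div_add_atTop_nhds_zero_nat.comp tendsto_snd
  simpa using h.const_add c

theorem IsLInftySpace.exists_bidual_approx_left_inverse {lam : ℝ} (hlam : 0 < lam)
    (hX : IsLInftySpace lam X) {ε : ℝ} {f : X → Y} (hf : IsStandardEpsIsometry ε f) :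
    ∃ T : Y →L[ℝ] StrongDual ℝ (StrongDual ℝ X), ‖T‖ ≤ lam ∧
      ∀ x : X, ‖T (f x) - inclusionInDoubleDual ℝ X x‖ ≤ 3 * ε * lam := by
  classical
  have key : ∀ p : Finset X × ℕ, ∃ S : Y →L[ℝ] X, ‖S‖ ≤ lam + 1 / ((p.2 : ℝ) + 1) ∧
      ∀ x ∈ p.1, ‖S (f x) - x‖ ≤ 3 * ε * (lam + 1 / ((p.2 : ℝ) + 1)) := by
    rintro ⟨s, m⟩
    obtain ⟨E, hsE, hE, n, A, hA⟩ := hX.exists_finset_subset hlam s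
      (δ := 1 / ((m : ℝ) + 1)) (by positivity)
    obtain ⟨S, hS, hSx⟩ := exists_approx_left_inverse A (f := fun x : E => f x)
      ⟨hf.eps_nonneg, hf.map_zero, fun x y => hf.abs_sub_le x y⟩ hA
    refine ⟨E.subtypeL.comp S, ?_, fun x hx => hSx ⟨x, hsE hx⟩⟩
    exact (ContinuousLinearMap.opNorm_le_bound _ (norm_nonneg _) fun y => S.le_opNorm y).trans hS
  choose S hS hSx using key
  have hlim := tendsto_const_add_one_div_snd (Finset X) lam
  obtain ⟨T, hT, hTx⟩ := exists_bidual_limit atTop S _ lam hS hlim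
  refine ⟨T, hT, fun x => hTx _ _ _ _ (hlim.const_mul (3 * ε)) ?_⟩
  filter_upwards [eventually_ge_atTop (({x} : Finset X), 0)] with p hp
  exact hSx p x (hp.1 (Finset.mem_singleton_self x))

theorem IsLInftySpace.exists_bidual_extension {lam : ℝ} (hlam : 0 < lam)
    (hX : IsLInftySpace lam X) (Z : Submodule ℝ Y) (T : Z →L[ℝ] X) :
    ∃ S : Y →L[ℝ] StrongDual ℝ (StrongDual ℝ X), ‖S‖ ≤ lam * ‖T‖ ∧
      ∀ z : Z, S z = inclusionInDoubleDual ℝ X (T z) := by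
  classical
  have key : ∀ p : Finset Z × ℕ, ∃ S : Y →L[ℝ] X,
      ‖S‖ ≤ (lam + 1 / ((p.2 : ℝ) + 1)) * ‖T‖ ∧ ∀ z ∈ p.1, S z = T z := by
    rintro ⟨s, m⟩
    obtain ⟨E, hsE, hE, n, A, hA⟩ := hX.exists_finset_subset hlam (s.image T)
      (δ := 1 / ((m : ℝ) + 1)) (by positivity)
    -- `T` need not map into `E`, so only its restriction to the preimage of `E` is extended; this
    -- preimage contains `s`.
    let G : Submodule ℝ Y := (E.comap T.toLinearMap).map Z.subtype
    have hmem : ∀ y : G, ∃ h : (y : Y) ∈ Z, T ⟨y, h⟩ ∈ E := by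
      rintro ⟨-, z, hz, rfl⟩
      exact ⟨z.2, hz⟩
    let T' : G →ₗ[ℝ] E := (T.toLinearMap ∘ₗ Submodule.inclusion
      (Submodule.map_subtype_le Z _)).codRestrict E fun y => (hmem y).2
    have hT' : ∀ y, ‖T' y‖ ≤ ‖T‖ * ‖y‖ := fun y => T.le_opNorm ⟨y, (hmem y).1⟩
    obtain ⟨S, hS, hSy⟩ := exists_extension_of_equiv_pi A hA G (T'.mkContinuous ‖T‖ hT')
    have hlamm : 0 ≤ lam + 1 / ((m : ℝ) + 1) := by positivity
    refine ⟨E.subtypeL.comp S, ?_, fun z hz => ?_⟩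
    · calc ‖E.subtypeL.comp S‖ ≤ ‖S‖ :=
            ContinuousLinearMap.opNorm_le_bound _ (norm_nonneg _) fun y => S.le_opNorm y
        _ ≤ _ := hS.trans (by gcongr; exact T'.mkContinuous_norm_le (norm_nonneg _) hT')
    · have hzE : T z ∈ E := hsE (Finset.mem_coe.2 (Finset.mem_image_of_mem T hz))
      exact congrArg Subtype.val (hSy ⟨z, z, hzE, rfl⟩)
  choose S hS hSx using key
  have hlim := (tendsto_const_add_one_div_snd (Finset Z) lam).mul_const ‖T‖
  obtain ⟨R, hR, hRx⟩ := exists_bidual_limit atTop S _ _ hS hlim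
  refine ⟨R, hR, fun z => sub_eq_zero.1 (norm_le_zero_iff.1
    (hRx _ _ (fun _ => 0) 0 tendsto_const_nhds ?_))⟩
  filter_upwards [eventually_ge_atTop (({z} : Finset Z), 0)] with p hp
  rw [hSx p z (hp.1 (Finset.mem_singleton_self z)), sub_self, norm_zero]

/-- A space isomorphic to a dual space is complemented in its bidual. -/
theorem exists_bidual_retraction {M : Type*} [NormedAddCommGroup M] [NormedSpace ℝ M]
    (e : X ≃L[ℝ] StrongDual ℝ M) :
    ∃ P : StrongDual ℝ (StrongDual ℝ X) →L[ℝ] X,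
      ‖P‖ ≤ ‖(e : X →L[ℝ] StrongDual ℝ M)‖ * ‖(e.symm : StrongDual ℝ M →L[ℝ] X)‖ ∧
      ∀ x, P (inclusionInDoubleDual ℝ X x) = x := by
  -- `R m` is the functional `x ↦ e x m`, and `Q ξ = ξ ∘ R` is the adjoint of `R`. It sends the
  -- canonical image of `x` to `e x`.
  let R : M →L[ℝ] StrongDual ℝ X := (e : X →L[ℝ] StrongDual ℝ M).flip
  let Q : StrongDual ℝ (StrongDual ℝ X) →L[ℝ] StrongDual ℝ M :=
    (ContinuousLinearMap.compL ℝ M (StrongDual ℝ X) ℝ).flip R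
  have hQ : ‖Q‖ ≤ ‖(e : X →L[ℝ] StrongDual ℝ M)‖ :=
    ContinuousLinearMap.opNorm_le_bound _ (norm_nonneg _) fun ξ => by
      rw [mul_comm, ← ContinuousLinearMap.opNorm_flip]
      exact ContinuousLinearMap.opNorm_comp_le ξ R
  refine ⟨(e.symm : StrongDual ℝ M →L[ℝ] X).comp Q, ?_, fun x => ?_⟩
  · refine (ContinuousLinearMap.opNorm_comp_le _ _).trans ?_
    rw [mul_comm]
    gcongr
  · have : Q (inclusionInDoubleDual ℝ X x) = e x := by
      ext m
      rfl
    simp [this]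

end LInfty

theorem theorem3p13 (X : Type u) [NormedAddCommGroup X] [NormedSpace ℝ X]
    [CompleteSpace X] (lam : ℝ) (hlam : 0 < lam) (hX : IsLInftySpace lam X) :
    (∀ (Y : Type v) [NormedAddCommGroup Y] [NormedSpace ℝ Y] [CompleteSpace Y]
      (ε : ℝ) (f : X → Y), IsStandardEpsIsometry ε f →
        ∃ T : Y →L[ℝ] StrongDual ℝ (StrongDual ℝ X), ‖T‖ ≤ lam ∧
          ∀ x : X, ‖T (f x) - NormedSpace.inclusionInDoubleDual ℝ X x‖ ≤ 4 * lam * ε) ∧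
    (∀ (M : Type w) [NormedAddCommGroup M] [NormedSpace ℝ M] [CompleteSpace M],
      Nonempty (X ≃L[ℝ] StrongDual ℝ M) →
      ∀ α : ℝ, banachMazurDist X (StrongDual ℝ M) < ENNReal.ofReal α →
        IsUniversallyLeftStable.{u, v} (lam * α) (4 * lam * α) X ∧
        IsInjectiveWithConst.{u, z} (lam * α) X) := by
  refine ⟨fun Y _ _ _ ε f hf => ?_, fun M _ _ _ _ α hα => ?_⟩
  · obtain ⟨T, hT, hTx⟩ := hX.exists_bidual_approx_left_inverse hlam hf
    refine ⟨T, hT, fun x => (hTx x).trans ?_⟩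
    -- The argument yields the constant 3, which is better than the required 4.
    nlinarith [mul_nonneg hf.eps_nonneg hlam.le]
  obtain ⟨e, he⟩ := exists_equiv_norm_mul_lt hα
  obtain ⟨P, hP, hPx⟩ := exists_bidual_retraction e
  have hPα : ‖P‖ ≤ α := hP.trans he.le
  have hα0 : 0 < α := lt_of_le_of_lt (by positivity) he
  refine ⟨fun Y _ _ _ ε f hf => ⟨by positivity, by positivity, ?_⟩, fun W _ _ _ Z _ T => ?_⟩
  · obtain ⟨T, hT, hTx⟩ := hX.exists_bidual_approx_left_inverse hlam hf
    have hε := hf.eps_nonneg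
    refine ⟨(P.comp T).comp (closedSpanRange f).subtypeL, ?_, fun x => ?_⟩
    · refine ContinuousLinearMap.opNorm_le_bound _ (by positivity) fun y => ?_
      calc ‖P (T y)‖ ≤ α * (lam * ‖(y : Y)‖) :=
            P.le_of_opNorm_le_of_le hPα (T.le_of_opNorm_le hT _)
        _ = lam * α * ‖y‖ := by rw [Submodule.coe_norm]; ring
    · have hx : P (T (f x)) - x = P (T (f x) - inclusionInDoubleDual ℝ X x) := by
        rw [map_sub, hPx]
      change ‖P (T (f x)) - x‖ ≤ _
      rw [hx]
      refine (P.le_of_opNorm_le_of_le hPα (hTx x)).trans ?_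
      nlinarith [mul_nonneg (mul_nonneg hα0.le hε) hlam.le]
  · obtain ⟨S, hS, hSz⟩ := hX.exists_bidual_extension hlam Z T
    refine ⟨P.comp S, fun z => ?_, ?_⟩
    · rw [ContinuousLinearMap.comp_apply, hSz, hPx]
    · calc ‖P.comp S‖ ≤ ‖P‖ * ‖S‖ := ContinuousLinearMap.opNorm_comp_le _ _
        _ ≤ α * (lam * ‖T‖) := by gcongr
        _ = lam * α * ‖T‖ := by ring
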